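/- Let $$T^*S^2=\{(u,v)\in\mathbb{R}^3\times\mathbb{R}^3 : \langle u,v\rangle=0,\ \|v\|=1\},\qquad \omega=du\wedge dv=\sum_i du_i\wedge dv_i,$$ let $\beta$ be the pullback under $(u,v)\mapsto v$ of the area form $\beta_v(X,Y)=\langle v,X\times Y\rangle$ on $S^2$, and put $\omega^s=\omega+s\beta$ for $s\in\mathbb{R}$. Write $\mathrm{Aut}^c(T^*S^2,\omega^s)$ for the group of compactly supported diffeomorphisms of $T^*S^2$ preserving $\omega^s$. For $u\neq 0$ let $$\sigma_t(u,v)=\Big(\cos(t)\,u-\sin(t)\,\|u\|\,v,\ \cos(t)\,v+\sin(t)\,\tfrac{u}{\|u\|}\Big).$$ A model Dehn twist is a map $\tau:T^*S^2\to T^*S^2$ of the form $\tau(u,v)=\sigma_{2\pi r'(\|u\|)}(u,v)$ for $u\neq 0$, $\tau(0,v)=(0,-v)$, where $r:\mathbb{R}\to\mathbb{R}$ is a smooth function with $r(t)=0$ for all sufficiently large $t$ and $r(-t)=r(t)-t$ for all $t$. Model Dehn twists exist, and for every model Dehn twist $\tau$ there is a smooth family $(\phi^s)_{s\in\mathbb{R}}$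 of compactly supported diffeomorphisms of $T^*S^2$ (that is, $(s,x)\mapsto\phi^s(x)$ is smooth, and the supports lie in a common compact set as long as $s$ stays in a compact set) such that: 1. $(\phi^s)^*\omega^s=\omega^s$ for all $s\in\mathbb{R}$; 2. for every $s\neq 0$, $\phi^s$ is isotopic to the identity in $\mathrm{Aut}^c(T^*S^2,\omega^s)$, that is, there is a smooth family $(\psi_t)_{t\in[0,1]}$ in $\mathrm{Aut}^c(T^*S^2,\omega^s)$, with supports in a common compact set, such that $\psi_0=\mathrm{id}$ and $\psi_1=\phi^s$; 3. $\phi^0=\tau^2$. -/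

import Mathlib

open scoped ContDiff

namespace CotS2

noncomputable section

/-- Euclidean three-space. -/
abbrev E3 : Type := EuclideanSpace ℝ (Fin 3)

/-- `T*S² = {(u, v) ∈ ℝ³ × ℝ³ : ⟨u, v⟩ = 0, ‖v‖ = 1}`, as a subset of `ℝ³ × ℝ³`: the point `v` of
the unit sphere is the base point, and `u` is the cotangent vector. -/
def carrier : Set (E3 × E3) := {x | inner ℝ x.1 x.2 = 0 ∧ ‖x.2‖ = 1}

/-- `T*S²` as a type, with the subspace topology. -/
abbrev TS2 : Type := carrier

/-- The tangent space of `T*S²` at `(u, v)`: the vectors `(U, V)` killed by the differentials of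
the two defining equations. -/
def tangent (x : TS2) : Set (E3 × E3) :=
  {X | inner ℝ X.1 x.1.2 + inner ℝ x.1.1 X.2 = 0 ∧ inner ℝ X.2 x.1.2 = 0}

/-- The standard form `ω = du ∧ dv = ∑ duᵢ ∧ dvᵢ`. -/
def omega (X Y : E3 × E3) : ℝ := inner ℝ X.1 Y.2 - inner ℝ X.2 Y.1

/-- The area form `β_v(X, Y) = ⟨v, X × Y⟩` of the sphere, pulled back under `(u, v) ↦ v`. -/
def beta (x : TS2) (X Y : E3 × E3) : ℝ :=
  inner ℝ x.1.2 (WithLp.toLp 2 (crossProduct (WithLp.ofLp X.2) (WithLp.ofLp Y.2)))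

/-- The deformed form `ω^s = ω + s β` at the point `x`. -/
def omegaS (s : ℝ) (x : TS2) (X Y : E3 × E3) : ℝ := omega X Y + s * beta x X Y

/-- Smoothness of a map on the submanifold `T*S²` of `ℝ³ × ℝ³`: near each point it is the
restriction of a smooth map on an open set of the ambient space. -/
def IsSmooth (f : TS2 → TS2) : Prop :=
  ∀ x : TS2, ∃ (U : Set (E3 × E3)) (F : E3 × E3 → E3 × E3),
    IsOpen U ∧ x.1 ∈ U ∧ ContDiffOn ℝ ∞ F U ∧ ∀ y : TS2, y.1 ∈ U → F y.1 = (f y).1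

/-- Joint smoothness of a family `f t`, `t ∈ I`, as a map `(t, x) ↦ f t x` on `I × T*S²`. -/
def IsJointlySmooth (I : Set ℝ) (f : ℝ → TS2 → TS2) : Prop :=
  ∀ t ∈ I, ∀ x : TS2, ∃ (U : Set (ℝ × (E3 × E3))) (F : ℝ × (E3 × E3) → E3 × E3),
    IsOpen U ∧ (t, x.1) ∈ U ∧ ContDiffOn ℝ ∞ F U ∧
      ∀ t' ∈ I, ∀ y : TS2, (t', y.1) ∈ U → F (t', y.1) = (f t' y).1

/-- A compactly supported diffeomorphism of `T*S²`. -/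
structure IsCompactDiffeo (f : TS2 ≃ TS2) : Prop where
  smooth : IsSmooth f
  smooth_symm : IsSmooth f.symm
  compact_support : ∃ K : Set TS2, IsCompact K ∧ ∀ x, x ∉ K → f x = x

/-- `f^* ω^s = ω^s`. The derivative `A` of `f` along `T*S²` is determined on tangent vectors;
`g` stands for `f` extended arbitrarily to the ambient space, and plays no role off `T*S²`. -/
def PreservesForm (s : ℝ) (f : TS2 → TS2) : Prop :=
  ∀ x : TS2, ∃ (g : E3 × E3 → E3 × E3) (A : E3 × E3 →L[ℝ] E3 × E3),
    (∀ y : TS2, g y.1 = (f y).1) ∧ HasFDerivWithinAt g A carrier x.1 ∧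
      ∀ X ∈ tangent x, ∀ Y ∈ tangent x, omegaS s (f x) (A X) (A Y) = omegaS s x X Y

/-- Membership in `Aut^c(T*S², ω^s)`: compactly supported diffeomorphisms preserving `ω^s`. -/
structure IsCompactSymplecto (s : ℝ) (f : TS2 ≃ TS2) : Prop extends IsCompactDiffeo f where
  preserves : PreservesForm s f

/-- A smooth family, with parameter `t ∈ I`, of compactly supported diffeomorphisms of `T*S²`:
it is jointly smooth, and the supports stay in a fixed compact set while the parameter stays in
a compact set (as for smooth maps into the group of compactly supported diffeomorphisms). -/
structure IsSmoothCompactFamily (I : Set ℝ) (f : ℝ → TS2 ≃ TS2) : Prop where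
  diffeo : ∀ t ∈ I, IsCompactDiffeo (f t)
  smooth : IsJointlySmooth I fun t => f t
  support : ∀ J ⊆ I, IsCompact J →
    ∃ K : Set TS2, IsCompact K ∧ ∀ t ∈ J, ∀ x, x ∉ K → f t x = x

/-- `f` is isotopic to the identity within `Aut^c(T*S², ω^s)`. -/
def IsIsotopicToId (s : ℝ) (f : TS2 ≃ TS2) : Prop :=
  ∃ ψ : ℝ → TS2 ≃ TS2, IsSmoothCompactFamily (Set.Icc 0 1) ψ ∧
    (∀ t ∈ Set.Icc (0 : ℝ) 1, IsCompactSymplecto s (ψ t)) ∧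
    ψ 0 = Equiv.refl TS2 ∧ ψ 1 = f

/-- The formula
`σ_t(u, v) = (cos t · u - sin t · ‖u‖ · v, cos t · v + sin t · u / ‖u‖)`. -/
def sigmaFun (t : ℝ) (x : E3 × E3) : E3 × E3 :=
  (Real.cos t • x.1 - (Real.sin t * ‖x.1‖) • x.2,
    Real.cos t • x.2 + (Real.sin t / ‖x.1‖) • x.1)

theorem sigmaFun_mem (t : ℝ) (x : TS2) (hx : x.1.1 ≠ 0) : sigmaFun t x.1 ∈ carrier := by
  obtain ⟨⟨u, v⟩, h, hv⟩ := x
  simp only at h hv hx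
  have hn : ‖u‖ ≠ 0 := norm_ne_zero_iff.mpr hx
  have h' : inner ℝ v u = 0 := by rw [real_inner_comm]; exact h
  constructor
  · simp only [sigmaFun, inner_sub_left, inner_add_right, real_inner_smul_left,
      real_inner_smul_right, h, h', real_inner_self_eq_norm_sq, hv]
    field_simp
    ring
  · have key : ‖(sigmaFun t (u, v)).2‖ ^ 2 = 1 := by
      rw [← real_inner_self_eq_norm_sq]
      simp only [sigmaFun, inner_add_left, inner_add_right, real_inner_smul_left,
        real_inner_smul_right, h, h']
      rw [real_inner_self_eq_norm_sq, real_inner_self_eq_norm_sq, hv]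
      field_simp
      linear_combination ‖u‖ * Real.cos_sq_add_sin_sq t
    exact (pow_eq_one_iff_of_nonneg (norm_nonneg _) two_ne_zero).mp key

/-- The normalized geodesic flow `σ_t` on the complement of the zero section. -/
def sigma (t : ℝ) (x : TS2) (hx : x.1.1 ≠ 0) : TS2 := ⟨sigmaFun t x.1, sigmaFun_mem t x hx⟩

/-- The functions `r` that define model Dehn twists: `r` is smooth, `r(t) = 0` for `t ≫ 0`, and
`r(-t) = r(t) - t`. -/
structure IsTwistProfile (r : ℝ → ℝ) : Prop where
  smooth : ContDiff ℝ ∞ r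
  eventually_zero : ∀ᶠ t in Filter.atTop, r t = 0
  reflect : ∀ t, r (-t) = r t - t

/-- The antipode `(0, -v)` of a point `(0, v)` of the zero section. -/
def zeroAntipode (x : TS2) : TS2 := ⟨(0, -x.1.2), by
  refine ⟨inner_zero_left _, ?_⟩
  rw [norm_neg]
  exact x.2.2⟩

open Classical in
/-- The model Dehn twist of `r`: `τ(u, v) = σ_{2π r'(‖u‖)}(u, v)` for `u ≠ 0`, and
`τ(0, v) = (0, -v)`. -/
def modelTwist (r : ℝ → ℝ) (x : TS2) : TS2 :=
  if hx : x.1.1 ≠ 0 then sigma (2 * Real.pi * deriv r ‖x.1.1‖) x hx else zeroAntipode x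

end

end CotS2

/-!
The rotation group acts on `(T*S², ω^s)` with moment map `μ(u, v) = u × v + s v`, and
`‖μ‖² = ‖u‖² + s²` on `T*S²`. Rotate each point `x` about `μ(x)`, by an angle `2 η(‖μ(x)‖)` that
depends only on the length of `μ(x)`. Such a twist preserves `μ` by equivariance, so it is
invertible, and it is symplectic for `ω^s` (`preservesForm_twistEquiv`): in classical terms it is
the time-one flow of a function of `‖μ‖`. No flow is needed in the proof. The rotation is written as
conjugation by the unit quaternion `c + k μ`, with `c = cos η(‖μ‖)` and `k = sin η(‖μ‖) / ‖μ‖`; the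
derivative of the twist at `x` is `X ↦ A (X + Ω(X) × x)`, for the rotation `A` at `x` and its body
angular velocity `Ω(X)`, and invariance of `ω^s` reduces by the moment map property to the identity
`inner_angVel` for vectors of `ℝ³`.

For `s = 0` and `u ≠ 0`, rotation by `-t` about `μ = u × v` is the normalized geodesic flow `σ_t`, so
`τ²` is the rotation by `-4π r'(‖μ‖)`, or equivalently by `2 η(‖μ‖)` with `η(t) = π - 2π r'(t)`. The
reflection property of `r` says precisely that `η` is odd. Hence `cos η(t)` and `sin η(t) / t` are
smooth even functions, their compositions with the norm are smooth at the origin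
(`exists_smooth_even_eq_mul_of_odd`, `contDiff_comp_norm_of_even`), and the twists with this `η` form
a smooth family over all `s`, equal to `τ²` at `s = 0`. They are compactly supported because the
angle is `2π` wherever `r' = 0`.

For `s ≠ 0` the vector `μ` has no zeros. Then the rotations by `-4π t r'(‖μ‖)`, `0 ≤ t ≤ 1`, are
smooth without any parity condition; each of them is a compactly supported symplectic twist, and
they connect the identity to the given twist (`isIsotopicToId_twistEquiv`).
-/

namespace CotS2

noncomputable section

/-! ### Even and odd smooth functions, and radial functions -/

/-- The weight `p` makes the family of these integrals closed under differentiation, which is what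
an induction on the order of differentiability needs. -/
theorem hasDerivAt_integral_weight_mul_comp {p h : ℝ → ℝ} (hp : Continuous p)
    (hh : ContDiff ℝ ∞ h) (t : ℝ) :
    HasDerivAt (fun t => ∫ s in (0 : ℝ)..1, p s * h (t * s))
      (∫ s in (0 : ℝ)..1, (p s * s) * deriv h (t * s)) t := by
  have hh' : Continuous (deriv h) := hh.continuous_deriv (by simp)
  have hd : Differentiable ℝ h := hh.differentiable (by simp)
  have hcont : Continuous fun x : ℝ × ℝ => (p x.2 * x.2) * deriv h (x.1 * x.2) := by fun_prop
  obtain ⟨C, hC⟩ := ((isCompact_Icc (a := t - 1) (b := t + 1)).prod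
    (isCompact_Icc (a := (0 : ℝ)) (b := 1))).exists_bound_of_continuousOn hcont.continuousOn
  refine (intervalIntegral.hasDerivAt_integral_of_dominated_loc_of_deriv_le
    (F' := fun t s => (p s * s) * deriv h (t * s)) (bound := fun _ => C)
    (Icc_mem_nhds (sub_one_lt t) (lt_add_one t)) ?_ ?_ ?_ ?_ ?_ ?_).2
  · have := hh.continuous
    exact .of_forall fun x => Continuous.aestronglyMeasurable (by fun_prop)
  · have := hh.continuous
    exact Continuous.intervalIntegrable (by fun_prop) _ _
  · exact Continuous.aestronglyMeasurable (by fun_prop)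
  · refine .of_forall fun s hs x hx => hC (x, s) ⟨hx, ?_⟩
    rw [Set.uIoc_of_le zero_le_one] at hs
    exact ⟨hs.1.le, hs.2⟩
  · simp
  · refine .of_forall fun s _ x _ => ?_
    have h1 : HasDerivAt (fun x : ℝ => x * s) s x := by simpa using (hasDerivAt_id x).mul_const s
    have h2 := ((hd (x * s)).hasDerivAt.comp x h1).const_mul (p s)
    exact h2.congr_deriv (by ring)

theorem contDiff_integral_weight_mul_comp (n : ℕ) {p h : ℝ → ℝ} (hp : Continuous p)
    (hh : ContDiff ℝ ∞ h) :
    ContDiff ℝ n (fun t => ∫ s in (0 : ℝ)..1, p s * h (t * s)) := by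
  induction n generalizing p h with
  | zero =>
    exact contDiff_zero.2 (continuous_iff_continuousAt.2 fun t =>
      (hasDerivAt_integral_weight_mul_comp hp hh t).continuousAt)
  | succ n ih =>
    have hd := hasDerivAt_integral_weight_mul_comp hp hh
    refine (contDiff_succ_iff_deriv (n := n)).2 ⟨fun t => (hd t).differentiableAt, by simp, ?_⟩
    rw [funext fun t => (hd t).deriv]
    exact ih (by fun_prop) (contDiff_infty_iff_deriv.1 hh).2

/-- Hadamard's lemma for odd functions: the quotient by the coordinate is `∫₀¹ f'(ts) ds`. -/
theorem exists_smooth_even_eq_mul_of_odd {f : ℝ → ℝ} (hf : ContDiff ℝ ∞ f)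
    (hodd : ∀ t, f (-t) = -f t) :
    ∃ k : ℝ → ℝ, ContDiff ℝ ∞ k ∧ (∀ t, k (-t) = k t) ∧ ∀ t, f t = t * k t := by
  have hd := (contDiff_infty_iff_deriv.1 hf).2
  have heven : ∀ t, deriv f (-t) = deriv f t := fun t => by
    have h1 := deriv_comp_neg (f := f) (x := t)
    have h2 : (fun x => f (-x)) = fun x => -f x := funext hodd
    rw [h2, deriv.fun_neg] at h1
    linarith
  refine ⟨fun t => ∫ s in (0 : ℝ)..1, 1 * deriv f (t * s), contDiff_infty.2 fun n =>
    contDiff_integral_weight_mul_comp n continuous_const hd, fun t => ?_, fun t => ?_⟩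
  · simp [neg_mul, heven]
  · have h0 : f 0 = 0 := by have := hodd 0; rw [neg_zero] at this; linarith
    have h1 : ∫ x in t * 0..t * 1, deriv f x = f t := by
      rw [intervalIntegral.integral_deriv_eq_sub
        (fun x _ => hf.differentiable (by simp) x)
        (hd.continuous.intervalIntegrable _ _)]
      simp [h0]
    simp only [one_mul]
    rw [intervalIntegral.mul_integral_comp_mul_left, h1]

theorem deriv_odd_of_even {f : ℝ → ℝ} (heven : ∀ t, f (-t) = f t) (t : ℝ) :
    deriv f (-t) = -deriv f t := by
  have h := deriv_comp_neg (f := f) (x := t)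
  rw [funext heven] at h
  linarith

section Radial

variable {F : Type*} [NormedAddCommGroup F] [InnerProductSpace ℝ F]

/-- The gradient of a radial function `f(‖y‖)` is `(f'(‖y‖) / ‖y‖) y`, also at the origin if `f'`
is divisible by the coordinate there. -/
theorem hasFDerivAt_comp_norm {f k : ℝ → ℝ} {y : F} (hf : HasDerivAt f (‖y‖ * k ‖y‖) ‖y‖) :
    HasFDerivAt (fun y : F => f ‖y‖) (k ‖y‖ • innerSL ℝ y) y := by
  by_cases hy : y = 0
  · subst hy
    simp only [norm_zero, zero_mul] at hf
    rw [hasDerivAt_iff_isLittleO] at hf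
    rw [hasFDerivAt_iff_isLittleO]
    have ht : Filter.Tendsto (fun y : F => ‖y‖) (nhds 0) (nhds 0) := by
      simpa using (continuous_norm (E := F)).tendsto 0
    have := hf.comp_tendsto ht
    refine Asymptotics.isLittleO_norm_right.1 ?_
    simpa [Function.comp_def] using this
  · have hn : ‖y‖ ≠ 0 := norm_ne_zero_iff.2 hy
    have h1 : HasFDerivAt (fun y : F => ‖y‖) (‖y‖⁻¹ • innerSL ℝ y) y := by
      have h2 := (hasStrictFDerivAt_norm_sq y).hasFDerivAt.sqrt (by positivity)
      simp only [Real.sqrt_sq (norm_nonneg _)] at h2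
      refine h2.congr_fderiv ?_
      ext z
      simp
      field_simp
    refine (hf.comp_hasFDerivAt y h1).congr_fderiv ?_
    ext z
    simp
    field_simp

/-- By induction on the order: the gradient of `f(‖y‖)` is `k(‖y‖) y`, where `k(t) = f'(t) / t` is
again smooth and even. -/
theorem contDiff_comp_norm_of_even {f : ℝ → ℝ} (hf : ContDiff ℝ ∞ f) (heven : ∀ t, f (-t) = f t) :
    ContDiff ℝ ∞ (fun y : F => f ‖y‖) := by
  refine contDiff_infty.2 fun n => ?_
  induction n generalizing f with
  | zero => exact contDiff_zero.2 (hf.continuous.comp continuous_norm)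
  | succ n ih =>
    obtain ⟨k, hk, hke, hfk⟩ :=
      exists_smooth_even_eq_mul_of_odd (contDiff_infty_iff_deriv.1 hf).2
        (deriv_odd_of_even heven)
    refine contDiff_succ_iff_hasFDerivAt.2 ⟨fun y => k ‖y‖ • innerSL ℝ y, ?_, fun y => ?_⟩
    · exact (ih hk hke).smul (innerSL ℝ).contDiff
    · refine hasFDerivAt_comp_norm ?_
      rw [← hfk]
      exact (hf.differentiable (by simp) _).hasDerivAt

end Radial

/-! ### Cross product and rotations of three-space -/

/-- The cross product of Euclidean three-space, as a continuous bilinear map. -/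
def cross : E3 →L[ℝ] E3 →L[ℝ] E3 :=
  LinearMap.toContinuousBilinearMap <|
    LinearMap.mk₂ ℝ (fun a b : E3 => WithLp.toLp 2 (crossProduct (WithLp.ofLp a) (WithLp.ofLp b)))
      (fun a b c => by simp) (fun r a b => by simp) (fun a b c => by simp) (fun r a b => by simp)

theorem cross_eq_toLp (a b : E3) :
    cross a b = WithLp.toLp 2 (crossProduct (WithLp.ofLp a) (WithLp.ofLp b)) := rfl

@[simp] theorem cross_apply_zero (a b : E3) : cross a b 0 = a 1 * b 2 - a 2 * b 1 := by
  simp [cross_eq_toLp, cross_apply]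

@[simp] theorem cross_apply_one (a b : E3) : cross a b 1 = a 2 * b 0 - a 0 * b 2 := by
  simp [cross_eq_toLp, cross_apply]

@[simp] theorem cross_apply_two (a b : E3) : cross a b 2 = a 0 * b 1 - a 1 * b 0 := by
  simp [cross_eq_toLp, cross_apply]

theorem inner_eq_coord (a b : E3) : inner ℝ a b = a 0 * b 0 + a 1 * b 1 + a 2 * b 2 := by
  simp [PiLp.inner_apply, Fin.sum_univ_three, mul_comm]

theorem norm_sq_eq_coord (a : E3) : ‖a‖ ^ 2 = a 0 ^ 2 + a 1 ^ 2 + a 2 ^ 2 := by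
  rw [← real_inner_self_eq_norm_sq, inner_eq_coord]; ring

theorem ext_coord {a b : E3} (h0 : a 0 = b 0) (h1 : a 1 = b 1) (h2 : a 2 = b 2) : a = b := by
  ext i; fin_cases i <;> assumption

theorem beta_eq (x : TS2) (X Y : E3 × E3) : beta x X Y = inner ℝ x.1.2 (cross X.2 Y.2) := rfl

/-- The rotation of three-space by the quaternion with real part `c` and imaginary part `k • m`.
It is orthogonal if this is a unit quaternion, that is, if `c ^ 2 + k ^ 2 * ‖m‖ ^ 2 = 1`; the
axis is then `m`, and the angle is twice the argument of `c + i k ‖m‖`. -/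
def rot (c k : ℝ) (m x : E3) : E3 :=
  x + (2 * c * k) • cross m x + (2 * k ^ 2) • cross m (cross m x)

section Rot

variable {c k : ℝ} {m : E3}

@[simp] theorem rot_zero_right (c : ℝ) (m x : E3) : rot c 0 m x = x := by simp [rot]

@[simp] theorem rot_neg_neg (c k : ℝ) (m x : E3) : rot (-c) (-k) m x = rot c k m x := by simp [rot]

theorem rot_axis (c k : ℝ) (m : E3) : rot c k m m = m := by
  apply ext_coord <;> simp [rot] <;> ring

theorem rot_add (c k : ℝ) (m x y : E3) : rot c k m (x + y) = rot c k m x + rot c k m y := by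
  simp only [rot, map_add, smul_add]; abel

theorem rot_smul (c k : ℝ) (m : E3) (r : ℝ) (x : E3) : rot c k m (r • x) = r • rot c k m x := by
  simp only [rot, map_smul, smul_add, smul_comm r]

theorem inner_rot (h : c ^ 2 + k ^ 2 * ‖m‖ ^ 2 = 1) (x y : E3) :
    inner ℝ (rot c k m x) (rot c k m y) = inner ℝ x y := by
  rw [norm_sq_eq_coord] at h
  have key : inner ℝ (rot c k m x) (rot c k m y) = inner ℝ x y +
      4 * k ^ 2 * inner ℝ (cross m x) (cross m y) *
        (c ^ 2 + k ^ 2 * (m 0 ^ 2 + m 1 ^ 2 + m 2 ^ 2) - 1) := by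
    simp only [inner_eq_coord, rot, PiLp.add_apply, PiLp.smul_apply, smul_eq_mul, cross_apply_zero,
      cross_apply_one, cross_apply_two]
    ring
  rw [key, h]; ring

theorem norm_rot (h : c ^ 2 + k ^ 2 * ‖m‖ ^ 2 = 1) (x : E3) : ‖rot c k m x‖ = ‖x‖ := by
  rw [← sq_eq_sq₀ (norm_nonneg _) (norm_nonneg _), ← real_inner_self_eq_norm_sq, inner_rot h,
    real_inner_self_eq_norm_sq]

theorem rot_neg_rot (h : c ^ 2 + k ^ 2 * ‖m‖ ^ 2 = 1) (x : E3) :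
    rot c (-k) m (rot c k m x) = x := by
  rw [norm_sq_eq_coord] at h
  apply ext_coord
  · linear_combination (norm := (simp only [rot, PiLp.add_apply, PiLp.smul_apply,
      smul_eq_mul, cross_apply_zero, cross_apply_one, cross_apply_two]; ring1))
      -4 * k ^ 2 * cross m (cross m x) 0 * h
  · linear_combination (norm := (simp only [rot, PiLp.add_apply, PiLp.smul_apply,
      smul_eq_mul, cross_apply_zero, cross_apply_one, cross_apply_two]; ring1))
      -4 * k ^ 2 * cross m (cross m x) 1 * h
  · linear_combination (norm := (simp only [rot, PiLp.add_apply, PiLp.smul_apply,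
      smul_eq_mul, cross_apply_zero, cross_apply_one, cross_apply_two]; ring1))
      -4 * k ^ 2 * cross m (cross m x) 2 * h

/-- Rotations commute with the cross product. The multiplier of `h` comes from the identity
`(q x q̄) × (q y q̄) = |q|² q (x × y) q̄`, valid for all quaternions `q`. -/
theorem cross_rot (h : c ^ 2 + k ^ 2 * ‖m‖ ^ 2 = 1) (x y : E3) :
    cross (rot c k m x) (rot c k m y) = rot c k m (cross x y) := by
  rw [norm_sq_eq_coord] at h
  apply ext_coord
  · linear_combination (norm := (simp only [rot, PiLp.add_apply, PiLp.sub_apply, PiLp.smul_apply,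
      smul_eq_mul, cross_apply_zero, cross_apply_one, cross_apply_two]; ring1))
      (rot c k m (cross x y) - cross x (rot c k m y) - cross (rot c k m x) y + cross x y) 0 * h
  · linear_combination (norm := (simp only [rot, PiLp.add_apply, PiLp.sub_apply, PiLp.smul_apply,
      smul_eq_mul, cross_apply_zero, cross_apply_one, cross_apply_two]; ring1))
      (rot c k m (cross x y) - cross x (rot c k m y) - cross (rot c k m x) y + cross x y) 1 * h
  · linear_combination (norm := (simp only [rot, PiLp.add_apply, PiLp.sub_apply, PiLp.smul_apply,
      smul_eq_mul, cross_apply_zero, cross_apply_one, cross_apply_two]; ring1))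
      (rot c k m (cross x y) - cross x (rot c k m y) - cross (rot c k m x) y + cross x y) 2 * h

/-- The derivative of `rot c k m x` with respect to `(c, k, m)` in direction `(c', k', n)`. -/
def rotDeriv (c k : ℝ) (m : E3) (c' k' : ℝ) (n x : E3) : E3 :=
  (2 * (c' * k + c * k')) • cross m x + (2 * c * k) • cross n x +
    (4 * k * k') • cross m (cross m x) +
    (2 * k ^ 2) • (cross n (cross m x) + cross m (cross n x))

/-- The body angular velocity of a moving rotation: twice the imaginary part of `q̄ q'`, for
`q = c + k m` and `q' = c' + k' m + k n`. -/
def angVel (c k : ℝ) (m : E3) (c' k' : ℝ) (n : E3) : E3 :=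
  (2 * (c * k' - k * c')) • m + (2 * c * k) • n - (2 * k ^ 2) • cross m n

/-- A moving rotation `A` satisfies `A' x = A (Ω × x)`, where `Ω` is its body angular velocity;
`h'` says that the quaternion stays a unit quaternion to first order.
The multipliers come from `A (Ω × x) = |q|² A' x - (|q|²)' A x`, valid for
`A x = q x q̄` and `Ω = 2 Im (q̄ q')` whether or not the quaternion `q` has norm one. -/
theorem rotDeriv_eq_rot_cross (h : c ^ 2 + k ^ 2 * ‖m‖ ^ 2 = 1) {c' k' : ℝ} {n : E3}
    (h' : c * c' + k * k' * ‖m‖ ^ 2 + k ^ 2 * inner ℝ m n = 0) (x : E3) :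
    rotDeriv c k m c' k' n x = rot c k m (cross (angVel c k m c' k' n) x) := by
  rw [norm_sq_eq_coord] at h h'
  rw [inner_eq_coord] at h'
  apply ext_coord
  · linear_combination (norm := (simp only [rot, rotDeriv, angVel, PiLp.add_apply, PiLp.sub_apply, PiLp.smul_apply,
      smul_eq_mul, cross_apply_zero, cross_apply_one, cross_apply_two]; ring1))
      -(rotDeriv c k m c' k' n x - cross (angVel c k m c' k' n) x) 0 * h -
        2 * (x - rot c k m x) 0 * h'
  · linear_combination (norm := (simp only [rot, rotDeriv, angVel, PiLp.add_apply, PiLp.sub_apply, PiLp.smul_apply,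
      smul_eq_mul, cross_apply_zero, cross_apply_one, cross_apply_two]; ring1))
      -(rotDeriv c k m c' k' n x - cross (angVel c k m c' k' n) x) 1 * h -
        2 * (x - rot c k m x) 1 * h'
  · linear_combination (norm := (simp only [rot, rotDeriv, angVel, PiLp.add_apply, PiLp.sub_apply, PiLp.smul_apply,
      smul_eq_mul, cross_apply_zero, cross_apply_one, cross_apply_two]; ring1))
      -(rotDeriv c k m c' k' n x - cross (angVel c k m c' k' n) x) 2 * h -
        2 * (x - rot c k m x) 2 * h'

end Rot
/-! ### The moment map, and twists along it -/

/-- The derivative of a moving rotation applied to a moving vector. -/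
theorem hasFDerivAt_rot {G : Type*} [NormedAddCommGroup G] [NormedSpace ℝ G] {c k : G → ℝ}
    {m x : G → E3} {c' k' : G →L[ℝ] ℝ} {m' x' : G →L[ℝ] E3} {p : G} (hc : HasFDerivAt c c' p)
    (hk : HasFDerivAt k k' p) (hm : HasFDerivAt m m' p) (hx : HasFDerivAt x x' p) :
    ∃ D : G →L[ℝ] E3, HasFDerivAt (fun p => rot (c p) (k p) (m p) (x p)) D p ∧
      ∀ X, D X = rot (c p) (k p) (m p) (x' X) +
        rotDeriv (c p) (k p) (m p) (c' X) (k' X) (m' X) (x p) := by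
  have h1 := cross.hasFDerivAt_of_bilinear hm hx
  have h2 := cross.hasFDerivAt_of_bilinear hm h1
  refine ⟨_, (hx.add (((hc.const_mul 2).mul hk).smul h1)).add (((hk.pow 2).const_mul 2).smul h2),
    fun X => ?_⟩
  simp [rot, rotDeriv]
  module

/-- The moment map of the rotation action on `(T*S², ω^s)`; its formula makes sense on all of
`ℝ³ × ℝ³`. -/
def moment (s : ℝ) (x : E3 × E3) : E3 := cross x.1 x.2 + s • x.2

/-- The derivative of the moment map. -/
def momentDeriv (s : ℝ) (x X : E3 × E3) : E3 := cross X.1 x.2 + cross x.1 X.2 + s • X.2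

theorem contDiff_moment : ContDiff ℝ ∞ fun p : ℝ × (E3 × E3) => moment p.1 p.2 := by
  unfold moment; fun_prop

theorem contDiff_moment_right (s : ℝ) : ContDiff ℝ ∞ (moment s) := by
  unfold moment; fun_prop

theorem hasFDerivAt_moment (s : ℝ) (x : E3 × E3) :
    ∃ D : E3 × E3 →L[ℝ] E3, HasFDerivAt (moment s) D x ∧ ∀ X, D X = momentDeriv s x X := by
  have h := cross.hasFDerivAt_of_bilinear (hasFDerivAt_fst (𝕜 := ℝ) (p := x)) hasFDerivAt_snd
  refine ⟨_, h.add (hasFDerivAt_snd.const_smul s), fun X => ?_⟩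
  simp [momentDeriv]
  module

theorem norm_sq_moment (s : ℝ) (x : TS2) : ‖moment s x.1‖ ^ 2 = ‖x.1.1‖ ^ 2 + s ^ 2 := by
  obtain ⟨⟨u, v⟩, h, hv⟩ := x
  have hv' : ‖v‖ ^ 2 = 1 := by simp only at hv; rw [hv]; norm_num
  simp only at h
  rw [inner_eq_coord] at h
  rw [norm_sq_eq_coord] at *
  simp only [moment, PiLp.add_apply, PiLp.smul_apply, smul_eq_mul, cross_apply_zero,
      cross_apply_one, cross_apply_two] at *
  rw [norm_sq_eq_coord]
  linear_combination (u 0 ^ 2 + u 1 ^ 2 + u 2 ^ 2 + s ^ 2) * hv' -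
    (u 0 * v 0 + u 1 * v 1 + u 2 * v 2) * h

theorem norm_le_norm_moment (s : ℝ) (x : TS2) : ‖x.1.1‖ ≤ ‖moment s x.1‖ := by
  refine (sq_le_sq₀ (norm_nonneg _) (norm_nonneg _)).1 ?_
  rw [norm_sq_moment]; nlinarith [sq_nonneg s]

theorem moment_ne_zero {s : ℝ} (hs : s ≠ 0) (x : TS2) : moment s x.1 ≠ 0 := by
  intro h
  have := norm_sq_moment s x
  rw [h, norm_zero] at this
  have : 0 < s ^ 2 := by positivity
  nlinarith [sq_nonneg ‖x.1.1‖]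

/-- The diagonal action of a rotation on `ℝ³ × ℝ³`. -/
def rotPair (c k : ℝ) (m : E3) (x : E3 × E3) : E3 × E3 := (rot c k m x.1, rot c k m x.2)

/-- The infinitesimal rotation with angular velocity `ξ`. -/
def infRot (ξ : E3) (x : E3 × E3) : E3 × E3 := (cross ξ x.1, cross ξ x.2)

theorem rotPair_mem {c k : ℝ} {m : E3} (h : c ^ 2 + k ^ 2 * ‖m‖ ^ 2 = 1) {x : E3 × E3}
    (hx : x ∈ carrier) : rotPair c k m x ∈ carrier :=
  ⟨(inner_rot h _ _).trans hx.1, (norm_rot h _).trans hx.2⟩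

theorem moment_rotPair {c k : ℝ} {m : E3} (h : c ^ 2 + k ^ 2 * ‖m‖ ^ 2 = 1) (s : ℝ)
    (x : E3 × E3) : moment s (rotPair c k m x) = rot c k m (moment s x) := by
  simp only [moment, rotPair, cross_rot h, rot_add, rot_smul]

theorem omegaS_rotPair {c k : ℝ} {m : E3} (h : c ^ 2 + k ^ 2 * ‖m‖ ^ 2 = 1) (s : ℝ)
    {x y : TS2} (hy : y.1 = rotPair c k m x.1) (X Y : E3 × E3) :
    omegaS s y (rotPair c k m X) (rotPair c k m Y) = omegaS s x X Y := by
  simp only [omegaS, omega, beta_eq, hy, rotPair, cross_rot h, inner_rot h]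

theorem omegaS_add_left (s : ℝ) (x : TS2) (X Y Z : E3 × E3) :
    omegaS s x (X + Y) Z = omegaS s x X Z + omegaS s x Y Z := by
  simp only [omegaS, omega, beta_eq, Prod.fst_add, Prod.snd_add, inner_add_left, map_add,
    add_apply, inner_add_right]
  ring

theorem omegaS_swap (s : ℝ) (x : TS2) (X Y : E3 × E3) : omegaS s x X Y = -omegaS s x Y X := by
  simp only [omegaS, omega, beta_eq, inner_eq_coord, cross_apply_zero, cross_apply_one,
    cross_apply_two]
  ring

/-- The defining property of a moment map. -/
theorem omegaS_infRot (s : ℝ) (x : TS2) (ξ : E3) {Y : E3 × E3} (hY : inner ℝ Y.2 x.1.2 = 0) :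
    omegaS s x (infRot ξ x.1) Y = inner ℝ ξ (momentDeriv s x.1 Y) := by
  obtain ⟨⟨u, v⟩, h, hv⟩ := x
  obtain ⟨U, V⟩ := Y
  have hv' : ‖v‖ ^ 2 = 1 := by simp only at hv; rw [hv]; norm_num
  simp only at hY
  rw [inner_eq_coord] at hY
  rw [norm_sq_eq_coord] at hv'
  simp only [omegaS, omega, beta_eq, infRot, momentDeriv, inner_eq_coord, PiLp.add_apply,
    PiLp.smul_apply, smul_eq_mul, cross_apply_zero, cross_apply_one, cross_apply_two]
  linear_combination s * (ξ 0 * V 0 + ξ 1 * V 1 + ξ 2 * V 2) * hv' -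
    s * (ξ 0 * v 0 + ξ 1 * v 1 + ξ 2 * v 2) * hY

/-- The moment map is equivariant. -/
theorem momentDeriv_infRot (s : ℝ) (x : E3 × E3) (ξ : E3) :
    momentDeriv s x (infRot ξ x) = cross ξ (moment s x) := by
  apply ext_coord <;> simp [momentDeriv, infRot, moment] <;> ring

theorem inner_infRot_snd (x : E3 × E3) (ξ : E3) : inner ℝ (infRot ξ x).2 x.2 = 0 := by
  simp only [infRot, inner_eq_coord, cross_apply_zero, cross_apply_one, cross_apply_two]
  ring

/-- The identity that makes rotation about the moment vector `m` symplectic, if `c` and `k` depend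
only on `‖m‖`, so that their derivatives are multiples of `n ↦ ⟨m, n⟩`. It is the Maurer–Cartan
equation of the angular velocity, evaluated on the moment vectors. -/
theorem inner_angVel {c k : ℝ} {m : E3} (h : c ^ 2 + k ^ 2 * ‖m‖ ^ 2 = 1) (c₁ k₁ : ℝ)
    (n n' : E3) :
    inner ℝ (angVel c k m (c₁ * inner ℝ m n) (k₁ * inner ℝ m n) n) n' -
      inner ℝ (angVel c k m (c₁ * inner ℝ m n') (k₁ * inner ℝ m n') n') n +
      inner ℝ (angVel c k m (c₁ * inner ℝ m n) (k₁ * inner ℝ m n) n)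
        (cross (angVel c k m (c₁ * inner ℝ m n') (k₁ * inner ℝ m n') n') m) = 0 := by
  rw [norm_sq_eq_coord] at h
  generalize hq : inner ℝ m n = q
  generalize hq' : inner ℝ m n' = q'
  rw [inner_eq_coord] at hq hq'
  simp only [angVel, inner_eq_coord, PiLp.add_apply, PiLp.sub_apply,
    PiLp.smul_apply, smul_eq_mul, cross_apply_zero, cross_apply_one, cross_apply_two]
  subst hq hq'
  -- The left side is `4 k² ⟨m, n × n'⟩ (c² + k² ‖m‖² - 1)`.
  linear_combination 4 * k ^ 2 * (m 0 * (n 1 * n' 2 - n 2 * n' 1) +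
      m 1 * (n 2 * n' 0 - n 0 * n' 2) + m 2 * (n 0 * n' 1 - n 1 * n' 0)) * h

/-- The twist with versor `(c, k)`: the point `x` is rotated by the quaternion `c + k μ`, where `μ`
is the moment vector of `x`, and `c` and `k` are evaluated at `μ`. -/
def twist (s : ℝ) (c k : E3 → ℝ) (x : E3 × E3) : E3 × E3 :=
  rotPair (c (moment s x)) (k (moment s x)) (moment s x) x

/-- The real and imaginary parts `c`, `k` at the moment vectors of `T*S²` form unit quaternions. -/
def IsVersor (s : ℝ) (c k : E3 → ℝ) : Prop :=
  ∀ x : TS2, c (moment s x.1) ^ 2 + k (moment s x.1) ^ 2 * ‖moment s x.1‖ ^ 2 = 1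

theorem IsVersor.neg {s : ℝ} {c k : E3 → ℝ} (h : IsVersor s c k) : IsVersor s c (-k) :=
  fun x => by simpa using h x

theorem moment_twist {s : ℝ} {c k : E3 → ℝ} (h : IsVersor s c k) (x : TS2) :
    moment s (twist s c k x.1) = moment s x.1 := by
  rw [twist, moment_rotPair (h x), rot_axis]

theorem twist_neg_twist {s : ℝ} {c k : E3 → ℝ} (h : IsVersor s c k) (x : TS2) :
    twist s c (-k) (twist s c k x.1) = x.1 := by
  rw [twist, moment_twist h]
  exact Prod.ext (rot_neg_rot (h x) _) (rot_neg_rot (h x) _)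

/-- A twist as a bijection of `T*S²`. As it preserves the moment map, its inverse is the twist with
the conjugate versor. -/
def twistEquiv (s : ℝ) (c k : E3 → ℝ) (h : IsVersor s c k) : TS2 ≃ TS2 where
  toFun x := ⟨twist s c k x.1, rotPair_mem (h x) x.2⟩
  invFun x := ⟨twist s c (-k) x.1, rotPair_mem (h.neg x) x.2⟩
  left_inv x := Subtype.ext (twist_neg_twist h x)
  right_inv x := Subtype.ext (by simpa using twist_neg_twist h.neg x)

theorem coe_twistEquiv (s : ℝ) (c k : E3 → ℝ) (h : IsVersor s c k) (x : TS2) :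
    (twistEquiv s c k h x).1 = twist s c k x.1 := rfl

theorem preservesForm_twistEquiv {s : ℝ} {c k : E3 → ℝ} (h : IsVersor s c k)
    (hd : ∀ x : TS2, ∃ c₁ k₁ : ℝ,
      HasFDerivAt c (c₁ • innerSL ℝ (moment s x.1)) (moment s x.1) ∧
      HasFDerivAt k (k₁ • innerSL ℝ (moment s x.1)) (moment s x.1))
    (hn : ∀ x : TS2, ∀ᶠ y in nhds (moment s x.1), c y ^ 2 + k y ^ 2 * ‖y‖ ^ 2 = 1) :
    PreservesForm s (twistEquiv s c k h) := by
  intro x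
  obtain ⟨c₁, k₁, hc, hk⟩ := hd x
  obtain ⟨M, hM, hMe⟩ := hasFDerivAt_moment s x.1
  set m := moment s x.1 with hm
  have hN : c m ^ 2 + k m ^ 2 * ‖m‖ ^ 2 = 1 := h x
  have hN' : ∀ n : E3, c m * (c₁ * inner ℝ m n) + k m * (k₁ * inner ℝ m n) * ‖m‖ ^ 2 +
      k m ^ 2 * inner ℝ m n = 0 := fun n => by
    -- Differentiate the relation `c² + k² ‖y‖² = 1`.
    have h1 := (hc.pow 2).add ((hk.pow 2).mul (hasStrictFDerivAt_norm_sq m).hasFDerivAt)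
    have h2 := (hasFDerivAt_const (𝕜 := ℝ) (1 : ℝ) m).congr_of_eventuallyEq (hn x)
    have h3 := congrArg (fun L : E3 →L[ℝ] ℝ => L n) (h1.unique h2)
    simp at h3
    linear_combination h3 / 2
  obtain ⟨D₁, hD₁, hD₁e⟩ := hasFDerivAt_rot (hc.comp x.1 hM) (hk.comp x.1 hM) hM
    (hasFDerivAt_fst (𝕜 := ℝ) (p := x.1))
  obtain ⟨D₂, hD₂, hD₂e⟩ := hasFDerivAt_rot (hc.comp x.1 hM) (hk.comp x.1 hM) hM
    (hasFDerivAt_snd (𝕜 := ℝ) (p := x.1))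
  -- The derivative of the twist: add the body angular velocity, then rotate.
  have hD : ∀ X, D₁.prod D₂ X = rotPair (c m) (k m) m (X + infRot (angVel (c m) (k m) m
      (c₁ * inner ℝ m (momentDeriv s x.1 X)) (k₁ * inner ℝ m (momentDeriv s x.1 X))
      (momentDeriv s x.1 X)) x.1) := fun X => by
    refine Prod.ext ?_ ?_
    · simp [hD₁e, rotPair, rot_add, infRot, hMe, ← hm, rotDeriv_eq_rot_cross hN (hN' _)]
    · simp [hD₂e, rotPair, rot_add, infRot, hMe, ← hm, rotDeriv_eq_rot_cross hN (hN' _)]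
  refine ⟨twist s c k, D₁.prod D₂, fun y => rfl, (hD₁.prodMk hD₂).hasFDerivWithinAt,
    fun X hX Y hY => ?_⟩
  rw [hD, hD, omegaS_rotPair hN s (x := x) rfl]
  have key := inner_angVel hN c₁ k₁ (momentDeriv s x.1 X) (momentDeriv s x.1 Y)
  generalize angVel (c m) (k m) m (c₁ * inner ℝ m (momentDeriv s x.1 X))
    (k₁ * inner ℝ m (momentDeriv s x.1 X)) (momentDeriv s x.1 X) = ξ at key ⊢
  generalize angVel (c m) (k m) m (c₁ * inner ℝ m (momentDeriv s x.1 Y))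
    (k₁ * inner ℝ m (momentDeriv s x.1 Y)) (momentDeriv s x.1 Y) = η at key ⊢
  have e : omegaS s x (X + infRot ξ x.1) (Y + infRot η x.1) = omegaS s x X Y +
      (omegaS s x (infRot ξ x.1) Y - omegaS s x (infRot η x.1) X +
        omegaS s x (infRot ξ x.1) (infRot η x.1)) := by
    rw [omegaS_add_left, omegaS_swap s x X, omegaS_swap s x (infRot ξ x.1) (Y + _),
      omegaS_add_left, omegaS_add_left, omegaS_swap s x Y X, omegaS_swap s x Y,
      omegaS_swap s x (infRot η x.1) (infRot ξ x.1)]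
    ring
  rw [e, omegaS_infRot s x ξ hY.2, omegaS_infRot s x η hX.2,
    omegaS_infRot s x ξ (inner_infRot_snd _ _), momentDeriv_infRot, key, add_zero]

/-! ### Smoothness and supports of twists -/

theorem isCompact_norm_fst_le (C : ℝ) : IsCompact {x : TS2 | ‖x.1.1‖ ≤ C} := by
  rw [Subtype.isCompact_iff]
  have hcl : IsClosed carrier :=
    (isClosed_eq (by fun_prop) continuous_const).inter (isClosed_eq (by fun_prop) continuous_const)
  refine (((isCompact_closedBall (0 : E3) C).prod (isCompact_closedBall (0 : E3) 1)).inter_left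
    hcl).of_isClosed_subset ?_ ?_
  · have : IsClosed {x : E3 × E3 | ‖x.1‖ ≤ C} := isClosed_le (by fun_prop) continuous_const
    have h2 : (Subtype.val '' {x : TS2 | ‖x.1.1‖ ≤ C}) = carrier ∩ {x : E3 × E3 | ‖x.1‖ ≤ C} := by
      ext x; simp [and_comm]
    rw [h2]
    exact hcl.inter this
  · rintro _ ⟨x, hx, rfl⟩
    exact ⟨x.2, by simpa using hx, by simp [x.2.2]⟩

theorem contDiffOn_rotPair {G : Type*} [NormedAddCommGroup G] [NormedSpace ℝ G] {c k : G → ℝ}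
    {m : G → E3} {x : G → E3 × E3} {U : Set G} (hc : ContDiffOn ℝ ∞ c U) (hk : ContDiffOn ℝ ∞ k U)
    (hm : ContDiffOn ℝ ∞ m U) (hx : ContDiffOn ℝ ∞ x U) :
    ContDiffOn ℝ ∞ (fun p => rotPair (c p) (k p) (m p) (x p)) U := by
  unfold rotPair rot
  fun_prop

theorem twist_eq_self {s : ℝ} {c k : E3 → ℝ} {x : E3 × E3} (h : k (moment s x) = 0) :
    twist s c k x = x := by
  simp [twist, rotPair, h]

theorem isSmooth_of_eq_twist {s : ℝ} {c k : E3 → ℝ} {V : Set E3} (hV : IsOpen V)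
    (hmem : ∀ x : TS2, moment s x.1 ∈ V) (hc : ContDiffOn ℝ ∞ c V) (hk : ContDiffOn ℝ ∞ k V)
    {f : TS2 → TS2} (hf : ∀ x, (f x).1 = twist s c k x.1) : IsSmooth f := by
  have hm := contDiff_moment_right s
  refine fun x => ⟨moment s ⁻¹' V, twist s c k, hV.preimage hm.continuous, hmem x, ?_,
    fun y _ => (hf y).symm⟩
  have hc' := hc.comp hm.contDiffOn (Set.mapsTo_preimage (moment s) V)
  have hk' := hk.comp hm.contDiffOn (Set.mapsTo_preimage (moment s) V)
  change ContDiffOn ℝ ∞ (fun p => rotPair (c (moment s p)) (k (moment s p)) (moment s p) p) _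
  exact contDiffOn_rotPair hc' hk' hm.contDiffOn contDiffOn_id

theorem twistEquiv_eq_self_of_lt {s C : ℝ} {c k : E3 → ℝ} (h : IsVersor s c k)
    (hC : ∀ y, C ≤ ‖y‖ → k y = 0) {x : TS2} (hx : C < ‖x.1.1‖) : twistEquiv s c k h x = x :=
  Subtype.ext (twist_eq_self (hC _ (hx.le.trans (norm_le_norm_moment s x))))

theorem isCompactDiffeo_twistEquiv {s C : ℝ} {c k : E3 → ℝ} (h : IsVersor s c k) {V : Set E3}
    (hV : IsOpen V) (hmem : ∀ x : TS2, moment s x.1 ∈ V) (hc : ContDiffOn ℝ ∞ c V)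
    (hk : ContDiffOn ℝ ∞ k V) (hC : ∀ y, C ≤ ‖y‖ → k y = 0) :
    IsCompactDiffeo (twistEquiv s c k h) where
  smooth := isSmooth_of_eq_twist hV hmem hc hk fun _ => rfl
  smooth_symm := isSmooth_of_eq_twist hV hmem hc hk.neg fun _ => rfl
  compact_support := ⟨_, isCompact_norm_fst_le C, fun _ hx =>
    twistEquiv_eq_self_of_lt h hC (not_le.1 hx)⟩

/-! ### Twist profiles -/

section Profile

variable {r : ℝ → ℝ}

theorem IsTwistProfile.contDiff_deriv (hr : IsTwistProfile r) : ContDiff ℝ ∞ (deriv r) :=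
  (contDiff_infty_iff_deriv.1 hr.smooth).2

theorem IsTwistProfile.deriv_neg (hr : IsTwistProfile r) (t : ℝ) :
    deriv r (-t) = 1 - deriv r t := by
  have h1 := deriv_comp_neg (f := r) (x := t)
  rw [funext hr.reflect, deriv_fun_sub (hr.smooth.differentiable (by simp) t)
    differentiableAt_fun_id, deriv_id''] at h1
  linarith

theorem IsTwistProfile.exists_deriv_eq_zero (hr : IsTwistProfile r) :
    ∃ C, ∀ t, C ≤ t → deriv r t = 0 := by
  obtain ⟨C, hC⟩ := Filter.eventually_atTop.1 hr.eventually_zero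
  refine ⟨C + 1, fun t ht => ?_⟩
  have : r =ᶠ[nhds t] fun _ => (0 : ℝ) :=
    (eventually_gt_nhds (show C < t by linarith)).mono fun u hu => hC u hu.le
  rw [this.deriv_eq, deriv_const]

/-- A profile is `r(t) = t χ((1 - t) / 2)` for the smooth transition `χ` from `0` to `1`; the
reflection property is `χ(x) + χ(1 - x) = 1`. -/
theorem exists_isTwistProfile : ∃ r : ℝ → ℝ, IsTwistProfile r := by
  refine ⟨fun t => t * Real.smoothTransition ((1 - t) / 2), ?_, ?_, fun t => ?_⟩
  · exact contDiff_id.mul (Real.smoothTransition.contDiff.comp (by fun_prop))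
  · filter_upwards [Filter.eventually_ge_atTop 1] with t ht
    rw [Real.smoothTransition.zero_of_nonpos (by linarith), mul_zero]
  · have key : Real.smoothTransition ((1 - t) / 2) + Real.smoothTransition ((1 - -t) / 2) = 1 := by
      have h := (Real.smoothTransition.pos_denom ((1 - t) / 2)).ne'
      have e : 1 - (1 - t) / 2 = (1 - -t) / 2 := by ring
      have e' : 1 - (1 - -t) / 2 = (1 - t) / 2 := by ring
      rw [Real.smoothTransition, Real.smoothTransition, e']
      rw [e] at h ⊢
      rw [add_comm (expNegInvGlue ((1 - -t) / 2)), ← add_div, div_self h]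
    linear_combination -t * key

end Profile

/-! ### Twists by radial angles are symplectic -/

theorem exists_hasFDerivAt_comp_norm_of_even {f : ℝ → ℝ} (hf : ContDiff ℝ ∞ f)
    (heven : ∀ t, f (-t) = f t) (y : E3) :
    ∃ a : ℝ, HasFDerivAt (fun y : E3 => f ‖y‖) (a • innerSL ℝ y) y := by
  obtain ⟨k, -, -, hfk⟩ := exists_smooth_even_eq_mul_of_odd (contDiff_infty_iff_deriv.1 hf).2
    (deriv_odd_of_even heven)
  refine ⟨_, hasFDerivAt_comp_norm (k := k) ?_⟩
  rw [← hfk]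
  exact (hf.differentiable (by simp) _).hasDerivAt

theorem exists_hasFDerivAt_comp_norm_of_ne_zero {f : ℝ → ℝ} {y : E3} (hy : y ≠ 0)
    (hf : DifferentiableAt ℝ f ‖y‖) :
    ∃ a : ℝ, HasFDerivAt (fun y : E3 => f ‖y‖) (a • innerSL ℝ y) y := by
  refine ⟨_, hasFDerivAt_comp_norm (k := fun t => deriv f t / t) ?_⟩
  rw [mul_div_cancel₀ _ (norm_ne_zero_iff.2 hy)]
  exact hf.hasDerivAt

/-- Radial versors with smooth even profiles define symplectic twists for all `s`. -/
theorem isCompactSymplecto_twistEquiv_of_even {s C : ℝ} {c k : ℝ → ℝ}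
    (hc : ContDiff ℝ ∞ c) (hce : ∀ t, c (-t) = c t) (hk : ContDiff ℝ ∞ k)
    (hke : ∀ t, k (-t) = k t) (h : ∀ t, c t ^ 2 + k t ^ 2 * t ^ 2 = 1) (hC : ∀ t, C ≤ t → k t = 0)
    (hv : IsVersor s (fun y => c ‖y‖) (fun y => k ‖y‖)) :
    IsCompactSymplecto s (twistEquiv s (fun y => c ‖y‖) (fun y => k ‖y‖) hv) where
  toIsCompactDiffeo := isCompactDiffeo_twistEquiv hv isOpen_univ (fun _ => trivial)
    (contDiff_comp_norm_of_even hc hce).contDiffOn (contDiff_comp_norm_of_even hk hke).contDiffOn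
    fun y hy => hC _ hy
  preserves := by
    refine preservesForm_twistEquiv hv (fun x => ?_) fun x => .of_forall fun y => h _
    obtain ⟨a, ha⟩ := exists_hasFDerivAt_comp_norm_of_even hc hce (moment s x.1)
    obtain ⟨b, hb⟩ := exists_hasFDerivAt_comp_norm_of_even hk hke (moment s x.1)
    exact ⟨a, b, ha, hb⟩

/-- For `s ≠ 0` the moment vector does not vanish, so the profiles of a radial versor need to be
smooth only away from `0`. -/
theorem isCompactSymplecto_twistEquiv_of_ne_zero {s C : ℝ} (hs : s ≠ 0) {c k : ℝ → ℝ}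
    (hc : ContDiffOn ℝ ∞ c {0}ᶜ) (hk : ContDiffOn ℝ ∞ k {0}ᶜ)
    (h : ∀ t, t ≠ 0 → c t ^ 2 + k t ^ 2 * t ^ 2 = 1) (hC : ∀ t, C ≤ t → k t = 0)
    (hv : IsVersor s (fun y => c ‖y‖) (fun y => k ‖y‖)) :
    IsCompactSymplecto s (twistEquiv s (fun y => c ‖y‖) (fun y => k ‖y‖) hv) where
  toIsCompactDiffeo := by
    have hn : ContDiffOn ℝ ∞ (fun y : E3 => ‖y‖) {0}ᶜ := contDiffOn_id.norm ℝ fun y hy => hy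
    exact isCompactDiffeo_twistEquiv hv isOpen_compl_singleton (moment_ne_zero hs)
      (hc.comp hn fun y hy => norm_ne_zero_iff.2 hy)
      (hk.comp hn fun y hy => norm_ne_zero_iff.2 hy) fun y hy => hC _ hy
  preserves := by
    refine preservesForm_twistEquiv hv (fun x => ?_) fun x => ?_
    · have hx := moment_ne_zero hs x
      have hd : ∀ {f : ℝ → ℝ}, ContDiffOn ℝ ∞ f {0}ᶜ →
          DifferentiableAt ℝ f ‖moment s x.1‖ := fun hf =>
        (hf.differentiableOn (by simp)).differentiableAt
          (isOpen_compl_singleton.mem_nhds (norm_ne_zero_iff.2 hx))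
      obtain ⟨a, ha⟩ := exists_hasFDerivAt_comp_norm_of_ne_zero hx (hd hc)
      obtain ⟨b, hb⟩ := exists_hasFDerivAt_comp_norm_of_ne_zero hx (hd hk)
      exact ⟨a, b, ha, hb⟩
    · filter_upwards [isOpen_compl_singleton.mem_nhds (moment_ne_zero hs x)] with y hy
      exact h _ (norm_ne_zero_iff.2 hy)

/-! ### Squares of model Dehn twists -/

/-- The geodesic flow rotates about `u × v`, the moment vector for `s = 0`, by the angle `-2t`; the
quaternion contains the half angle `-t`. -/
theorem sigmaFun_eq_rotPair (t : ℝ) (x : TS2) (hx : x.1.1 ≠ 0) :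
    sigmaFun (2 * t) x.1 =
      rotPair (Real.cos t) (-(Real.sin t / ‖x.1.1‖)) (moment 0 x.1) x.1 := by
  obtain ⟨⟨u, v⟩, h, hv⟩ := x
  simp only at h hv hx
  have hn : ‖u‖ ≠ 0 := norm_ne_zero_iff.2 hx
  have hu2 := norm_sq_eq_coord u
  have hv2 := norm_sq_eq_coord v
  rw [hv] at hv2
  rw [inner_eq_coord] at h
  have h1 : cross (cross u v) u = ‖u‖ ^ 2 • v := by
    apply ext_coord <;> simp [hu2]
    · linear_combination (-u 0) * h
    · linear_combination (-u 1) * h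
    · linear_combination (-u 2) * h
  have h2 : cross (cross u v) v = -u := by
    apply ext_coord <;> simp
    · linear_combination v 0 * h + u 0 * hv2
    · linear_combination v 1 * h + u 1 * hv2
    · linear_combination v 2 * h + u 2 * hv2
  have hcs := Real.cos_sq_add_sin_sq t
  simp only [sigmaFun, rotPair, rot, moment, zero_smul, add_zero, h1, h2, map_smul, map_neg,
    Real.cos_two_mul, Real.sin_two_mul]
  refine Prod.ext ?_ ?_
  · simp only
    match_scalars
    · field_simp
      linear_combination 2 * hcs
    · field_simp
  · simp only
    match_scalars
    · field_simp
      linear_combination 2 * hcs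
    · field_simp

theorem norm_sigmaFun_fst (t : ℝ) (x : TS2) : ‖(sigmaFun t x.1).1‖ = ‖x.1.1‖ := by
  obtain ⟨⟨u, v⟩, h, hv⟩ := x
  simp only at h hv
  have h' : inner ℝ v u = 0 := by rw [real_inner_comm]; exact h
  rw [← sq_eq_sq₀ (norm_nonneg _) (norm_nonneg _), ← real_inner_self_eq_norm_sq (sigmaFun _ _).1]
  simp only [sigmaFun, inner_sub_left, inner_sub_right, real_inner_smul_left,
    real_inner_smul_right, h, h', real_inner_self_eq_norm_sq u, real_inner_self_eq_norm_sq v, hv]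
  linear_combination ‖u‖ ^ 2 * Real.cos_sq_add_sin_sq t

theorem sigmaFun_sigmaFun (t : ℝ) (x : TS2) (hx : x.1.1 ≠ 0) :
    sigmaFun t (sigmaFun t x.1) = sigmaFun (2 * t) x.1 := by
  have h := norm_sigmaFun_fst t x
  obtain ⟨⟨u, v⟩, hmem⟩ := x
  have hn : ‖u‖ ≠ 0 := norm_ne_zero_iff.2 hx
  simp only at h
  rw [sigmaFun, h]
  simp only [sigmaFun, Real.cos_two_mul', Real.sin_two_mul]
  refine Prod.ext ?_ ?_
  · simp only
    match_scalars
    · field_simp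
    · ring
  · simp only
    match_scalars
    · field_simp
      ring
    · ring

theorem modelTwist_modelTwist_of_eq_zero (r : ℝ → ℝ) {x : TS2} (hx : x.1.1 = 0) :
    modelTwist r (modelTwist r x) = x := by
  have h1 : modelTwist r x = zeroAntipode x := dif_neg (not_not.2 hx)
  rw [h1, modelTwist, dif_neg (by simp [zeroAntipode])]
  exact Subtype.ext (Prod.ext hx.symm (neg_neg _))

theorem modelTwist_modelTwist_of_ne_zero (r : ℝ → ℝ) {x : TS2} (hx : x.1.1 ≠ 0) :
    (modelTwist r (modelTwist r x)).1 = sigmaFun (2 * (2 * Real.pi * deriv r ‖x.1.1‖)) x.1 := by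
  have h1 : (modelTwist r x).1 = sigmaFun (2 * Real.pi * deriv r ‖x.1.1‖) x.1 := by
    rw [modelTwist, dif_pos hx]; rfl
  have h2 : ‖(modelTwist r x).1.1‖ = ‖x.1.1‖ := by rw [h1, norm_sigmaFun_fst]
  have h3 : (modelTwist r x).1.1 ≠ 0 := by rw [← norm_ne_zero_iff, h2]; exact norm_ne_zero_iff.2 hx
  rw [modelTwist, dif_pos h3]
  change sigmaFun (2 * Real.pi * deriv r ‖(modelTwist r x).1.1‖) (modelTwist r x).1 = _
  rw [h2, h1, sigmaFun_sigmaFun _ _ hx]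

/-! ### The isotopy to the identity -/

/-- The isotopy turns by `t` times the angle: as the moment vector does not vanish for `s ≠ 0`, no
parity of the angle is needed for smoothness. -/
theorem isIsotopicToId_twistEquiv {s : ℝ} (hs : s ≠ 0) {a : ℝ → ℝ} {C : ℝ}
    (ha : ContDiff ℝ ∞ a) (hC : ∀ t, C ≤ t → a t = 0)
    (hv : IsVersor s (fun y => Real.cos (a ‖y‖)) (fun y => Real.sin (a ‖y‖) / ‖y‖)) :
    IsIsotopicToId s (twistEquiv s _ _ hv) := by
  have hver : ∀ t : ℝ, IsVersor s (fun y => Real.cos (t * a ‖y‖))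
      (fun y => Real.sin (t * a ‖y‖) / ‖y‖) := fun t x => by
    have := norm_ne_zero_iff.2 (moment_ne_zero hs x)
    field_simp
    exact Real.cos_sq_add_sin_sq _
  have hzero : ∀ t : ℝ, ∀ u, C ≤ u → Real.sin (t * a u) / u = 0 := fun t u hu => by simp [hC u hu]
  have hsymp : ∀ t : ℝ, IsCompactSymplecto s (twistEquiv s _ _ (hver t)) := fun t =>
    isCompactSymplecto_twistEquiv_of_ne_zero hs (c := fun u => Real.cos (t * a u))
      (k := fun u => Real.sin (t * a u) / u)
      (ContDiff.contDiffOn (by fun_prop))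
      (ContDiffOn.div (ContDiff.contDiffOn (by fun_prop)) contDiffOn_id fun u hu => hu)
      (fun u hu => by field_simp; exact Real.cos_sq_add_sin_sq _) (hzero t) (hver t)
  refine ⟨fun t => twistEquiv s _ _ (hver t), ⟨fun t _ => (hsymp t).toIsCompactDiffeo, ?_, ?_⟩,
    fun t _ => hsymp t, ?_, ?_⟩
  · have hm : ContDiff ℝ ∞ fun p : ℝ × (E3 × E3) => moment s p.2 :=
      (contDiff_moment_right s).comp contDiff_snd
    refine fun t _ x => ⟨{p | moment s p.2 ≠ 0}, fun p => twist s
      (fun y => Real.cos (p.1 * a ‖y‖)) (fun y => Real.sin (p.1 * a ‖y‖) / ‖y‖) p.2,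
      isOpen_ne_fun hm.continuous continuous_const, moment_ne_zero hs x, ?_,
      fun t' _ y _ => (coe_twistEquiv _ _ _ (hver t') y).symm⟩
    have hn : ContDiffOn ℝ ∞ (fun p : ℝ × (E3 × E3) => ‖moment s p.2‖)
        {p | moment s p.2 ≠ 0} := ContDiffOn.norm ℝ hm.contDiffOn fun p hp => hp
    have hang : ContDiffOn ℝ ∞ (fun p : ℝ × (E3 × E3) => p.1 * a ‖moment s p.2‖)
        {p | moment s p.2 ≠ 0} := contDiffOn_fst.mul (ha.comp_contDiffOn hn)
    change ContDiffOn ℝ ∞ (fun p : ℝ × (E3 × E3) => rotPair (Real.cos (p.1 * a ‖moment s p.2‖))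
      (Real.sin (p.1 * a ‖moment s p.2‖) / ‖moment s p.2‖) (moment s p.2) p.2) _
    exact contDiffOn_rotPair (Real.contDiff_cos.comp_contDiffOn hang)
      ((Real.contDiff_sin.comp_contDiffOn hang).div hn fun p hp => norm_ne_zero_iff.2 hp)
      hm.contDiffOn contDiffOn_snd
  · exact fun J _ _ => ⟨_, isCompact_norm_fst_le C, fun t _ x hx =>
      twistEquiv_eq_self_of_lt (hver t) (fun y => hzero t _) (not_le.1 hx)⟩
  · exact Equiv.ext fun x => Subtype.ext ((coe_twistEquiv _ _ _ _ x).trans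
      (twist_eq_self (by simp)))
  · exact Equiv.ext fun x => Subtype.ext (by simp only [coe_twistEquiv, one_mul])

end
end CotS2

/-- Model Dehn twists exist, and for each of them, `τ`, there is a smooth family `φ^s`, `s ∈ ℝ`, of
compactly supported diffeomorphisms of `T*S²` such that (1) `φ^s` is symplectic for `ω^s`; (2) for
`s ≠ 0`, `φ^s` is isotopic to the identity in `Aut^c(T*S², ω^s)`; (3) `φ^0 = τ²`. -/
theorem mainTheorem8 :
    (∃ r : ℝ → ℝ, CotS2.IsTwistProfile r) ∧
    ∀ r : ℝ → ℝ, CotS2.IsTwistProfile r →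
      ∃ φ : ℝ → CotS2.TS2 ≃ CotS2.TS2,
        CotS2.IsSmoothCompactFamily Set.univ φ ∧
        (∀ s : ℝ, CotS2.IsCompactSymplecto s (φ s)) ∧
        (∀ s : ℝ, s ≠ 0 → CotS2.IsIsotopicToId s (φ s)) ∧
        ∀ x : CotS2.TS2, φ 0 x = CotS2.modelTwist r (CotS2.modelTwist r x) := by
  refine ⟨CotS2.exists_isTwistProfile, fun r hr => ?_⟩
  set η : ℝ → ℝ := fun t => Real.pi - 2 * Real.pi * deriv r t with hη
  have hηs : ContDiff ℝ ∞ η := contDiff_const.sub (contDiff_const.mul hr.contDiff_deriv)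
  have hηo : ∀ t, η (-t) = -η t := fun t => by simp only [hη, hr.deriv_neg]; ring
  obtain ⟨k, hk, hke, hηk⟩ := CotS2.exists_smooth_even_eq_mul_of_odd
    (f := fun t => Real.sin (η t)) (by fun_prop) fun t => by rw [hηo, Real.sin_neg]
  have hc : ContDiff ℝ ∞ fun t => Real.cos (η t) := by fun_prop
  have hce : ∀ t, Real.cos (η (-t)) = Real.cos (η t) := fun t => by rw [hηo, Real.cos_neg]
  have hunit : ∀ t, Real.cos (η t) ^ 2 + k t ^ 2 * t ^ 2 = 1 := fun t => by
    linear_combination Real.cos_sq_add_sin_sq (η t) - (Real.sin (η t) + t * k t) * hηk t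
  have hcos : ∀ t, Real.cos (η t) = -Real.cos (2 * Real.pi * deriv r t) := fun t =>
    Real.cos_pi_sub _
  have hsin : ∀ t, t ≠ 0 → k t = Real.sin (2 * Real.pi * deriv r t) / t := fun t ht => by
    rw [← Real.sin_pi_sub]
    exact (eq_div_iff ht).2 (by rw [mul_comm]; exact (hηk t).symm)
  obtain ⟨C₀, hC₀⟩ := hr.exists_deriv_eq_zero
  -- A positive radius, so that `k` is given by the quotient `sin η(t) / t` beyond it.
  obtain ⟨C, hC, hC1⟩ : ∃ C : ℝ, (∀ t, C ≤ t → deriv r t = 0) ∧ 0 < C :=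
    ⟨max C₀ 1, fun t ht => hC₀ t ((le_max_left _ _).trans ht), by positivity⟩
  have hkC : ∀ t, C ≤ t → k t = 0 := fun t ht => by
    rw [hsin t (hC1.trans_le ht).ne', hC t ht]; simp
  have hver : ∀ s, CotS2.IsVersor s (fun y => Real.cos (η ‖y‖)) (fun y => k ‖y‖) :=
    fun s x => hunit _
  have hsymp := fun s => CotS2.isCompactSymplecto_twistEquiv_of_even hc hce hk hke hunit hkC
    (hver s)
  refine ⟨fun s => CotS2.twistEquiv s _ _ (hver s), ⟨fun s _ => (hsymp s).toIsCompactDiffeo,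
    fun s _ x => ⟨Set.univ, fun p => CotS2.twist p.1 _ _ p.2, isOpen_univ, trivial, ?_,
      fun s' _ y _ => (CotS2.coe_twistEquiv _ _ _ (hver s') y).symm⟩,
    fun J _ _ => ⟨_, CotS2.isCompact_norm_fst_le C, fun s _ x hx =>
      CotS2.twistEquiv_eq_self_of_lt (hver s) (fun y => hkC _) (not_le.1 hx)⟩⟩, hsymp,
      fun s hs => ?_, fun x => Subtype.ext ?_⟩
  · have hm := CotS2.contDiff_moment
    change ContDiffOn ℝ ∞ (fun p : ℝ × (CotS2.E3 × CotS2.E3) =>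
      CotS2.rotPair (Real.cos (η ‖CotS2.moment p.1 p.2‖)) (k ‖CotS2.moment p.1 p.2‖)
        (CotS2.moment p.1 p.2) p.2) _
    exact CotS2.contDiffOn_rotPair
      ((CotS2.contDiff_comp_norm_of_even hc hce).comp hm).contDiffOn
      ((CotS2.contDiff_comp_norm_of_even hk hke).comp hm).contDiffOn hm.contDiffOn contDiffOn_snd
  · have hv : CotS2.IsVersor s (fun y => Real.cos (-(2 * Real.pi * deriv r ‖y‖)))
        (fun y => Real.sin (-(2 * Real.pi * deriv r ‖y‖)) / ‖y‖) := fun x => by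
      have := norm_ne_zero_iff.2 (CotS2.moment_ne_zero hs x)
      field_simp
      exact Real.cos_sq_add_sin_sq _
    have h := CotS2.isIsotopicToId_twistEquiv hs (C := C)
      (a := fun t => -(2 * Real.pi * deriv r t))
      (contDiff_const.mul hr.contDiff_deriv).neg (fun t ht => by simp [hC t ht]) hv
    -- The two versors differ by a sign, as the half angles differ by half a turn.
    convert! h using 1
    refine Equiv.ext fun x => Subtype.ext ?_
    have hx := norm_ne_zero_iff.2 (CotS2.moment_ne_zero hs x)
    simp only [CotS2.coe_twistEquiv, CotS2.twist, CotS2.rotPair, hcos, hsin _ hx,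
      Real.cos_neg, Real.sin_neg, neg_div]
    rw [← CotS2.rot_neg_neg, ← CotS2.rot_neg_neg _ _ _ x.1.2, neg_neg]
  · by_cases hx : x.1.1 = 0
    · rw [CotS2.modelTwist_modelTwist_of_eq_zero r hx]
      have : CotS2.moment 0 x.1 = 0 := by simp [CotS2.moment, hx]
      simp [CotS2.coe_twistEquiv, CotS2.twist, CotS2.rotPair, CotS2.rot, this]
    · rw [CotS2.modelTwist_modelTwist_of_ne_zero r hx, CotS2.sigmaFun_eq_rotPair _ _ hx]
      have hn : ‖CotS2.moment 0 x.1‖ = ‖x.1.1‖ := by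
        rw [← sq_eq_sq₀ (norm_nonneg _) (norm_nonneg _), CotS2.norm_sq_moment]; ring
      simp only [CotS2.coe_twistEquiv, CotS2.twist, CotS2.rotPair, hn, hcos,
        hsin _ (norm_ne_zero_iff.2 hx)]
      rw [← CotS2.rot_neg_neg, ← CotS2.rot_neg_neg _ _ _ x.1.2, neg_neg]
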